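/- **Corollary (Coloured Radon theorem with tolerance).** Let $d \ge 2$ and $r \ge 0$ be integers, put $n = (r+1)d+1$, and let $F_1, \dots, F_n$ be pairs of points in $\mathbb{R}^d$, called colour classes. (The $2n$ points are regarded as labelled, so different classes may share points.) Call a set of these labelled points *colourful* if it contains exactly one point of each $F_j$. Then the $2n$ points can be split into two disjoint colourful sets $A_1 = \{x^1_1, \dots, x^1_n\}$ and $A_2 = \{x^2_1, \dots, x^2_n\}$, with $F_j = \{x^1_j, x^2_j\}$ for every $j$, such that for every set $C \subseteq \{1,\dots,n\}$ of exactly $r$ colour classes the convex hulls of what is left in $A_1$ and in $A_2$ intersect: $$\operatorname{conv}\{x^1_j : j \notin C\} \cap \operatorname{conv}\{x^2_j : j \notin C\} \neq \emptyset .$$ Moreover, they intersect with equal coefficients: for every such $C$ there are $\alpha_j \ge 0$ $(j \notin C)$ with $\sum_{j \notin C} \alpha_j = 1$ and $\sum_{j \notin C} \alpha_j x^1_j = \sum_{j \notin C} \alpha_j x^2_j$. -/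

import Mathlib

/- Colour classes are indexed by `ι`, and the points inside each class carry labels from `κ`; the
labelled point `(j, t)` is the `t`-th point of class `j`, and its position is `z j t`.  Working with
labelled points lets two classes share a point of the space. -/

/-- A set of labelled points is colourful if it has exactly one element of each colour class. -/
def IsColourful {ι κ : Type*} (A : Finset (ι × κ)) : Prop :=
  ∀ j : ι, ∃! t : κ, (j, t) ∈ A

/-- What is left of `A` after the colour classes in `C` have been removed. -/
def removeClasses {ι κ : Type*} [DecidableEq ι] (A : Finset (ι × κ)) (C : Finset ι) :
    Finset (ι × κ) :=
  A.filter fun p => p.1 ∉ C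

/-- The convex hull of the positions of the labelled points in `A`. -/
def colourHull {ι κ E : Type*} [AddCommGroup E] [Module ℝ E] (z : ι → κ → E)
    (A : Finset (ι × κ)) : Set E :=
  convexHull ℝ ((fun p : ι × κ => z p.1 p.2) '' (A : Set (ι × κ)))

/-- After removal of the classes in `C`, the convex hulls of the colourful sets `A` and `B` intersect
with equal coefficients: there are coefficients of a convex combination, one for each remaining
colour class, for which the combinations of the points of `A` and of `B` are the same point. -/
def MeetWithEqualCoefficients {ι κ E : Type*} [Fintype ι] [DecidableEq ι] [AddCommGroup E]
    [Module ℝ E] (z : ι → κ → E) (A B : Finset (ι × κ)) (C : Finset ι) : Prop :=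
  ∃ α : ι → ℝ, (∀ j ∉ C, 0 ≤ α j) ∧ ∑ j ∈ Finset.univ \ C, α j = 1 ∧
    ∑ p ∈ removeClasses A C, α p.1 • z p.1 p.2 = ∑ p ∈ removeClasses B C, α p.1 • z p.1 p.2

/-! Splitting each class amounts to choosing a sign for the difference `y j = z j 0 - z j 1`; equal
coefficients are a nonnegative dependence among the signed differences. So signs are needed for
which such a dependence survives any `r` deletions.

Induct on the tolerance. `exists_simplicial_cone` gives a signed independent set `S` such that every
other vector lies in its cone or in the negative. Sign the other vectors by induction, then flip the
cone so that at least `t + 1` of them lie opposite to it. If the deletion misses `S`, one of these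
survives and balances the cone; if it hits `S`, fewer than `t` deletions fall outside and induction
applies.

The cone comes from a generic `c`: take a basis maximising the ℓ¹ norm of the coordinates of `c`,
with their signs. -/

section SignedDependences

open Finset Module

variable {ι E : Type*} [AddCommGroup E] [Module ℝ E]

/-- A subspace `V` contains a vector avoiding all the proper subspaces of `V` that are spanned by a
subfamily of a given finite family. -/
lemma exists_generic_vector (y : ι → E) (J : Finset ι) :
    ∃ c ∈ Submodule.span ℝ (y '' J), ∀ T ⊆ J, c ∈ Submodule.span ℝ (y '' T) →
      Submodule.span ℝ (y '' T) = Submodule.span ℝ (y '' J) := by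
  classical
  set V := Submodule.span ℝ (y '' (J : Set ι)) with hV
  let s : Finset (Submodule ℝ V) :=
    (J.powerset.image fun T : Finset ι =>
      (Submodule.span ℝ (y '' (T : Set ι))).comap V.subtype).erase ⊤
  have hs : (⊤ : Submodule ℝ V) ∉ s := by simp [s]
  -- A real vector space is not a finite union of proper subspaces.
  have hne := Subspace.biUnion_ne_univ_of_top_notMem hs
  obtain ⟨c, hc⟩ := (Set.ne_univ_iff_exists_notMem _).1 hne
  refine ⟨c, c.2, fun T hT hcT => ?_⟩
  by_contra hTV
  apply hc
  simp only [Set.mem_iUnion]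
  refine ⟨(Submodule.span ℝ (y '' (T : Set ι))).comap V.subtype, ?_, hcT⟩
  simp only [s, mem_erase, mem_image, mem_powerset]
  refine ⟨fun h => hTV (le_antisymm ?_ ?_), T, hT, rfl⟩
  · exact Submodule.span_mono (Set.image_mono (by exact_mod_cast hT))
  · exact Submodule.comap_subtype_eq_top.1 h

lemma coeff_eq_of_linearIndepOn {y : ι → E} {T : Finset ι} (h : LinearIndepOn ℝ y (T : Set ι))
    {s t : ι → ℝ} (hst : ∑ i ∈ T, s i • y i = ∑ i ∈ T, t i • y i) : ∀ i ∈ T, s i = t i := by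
  intro i hi
  have := linearIndepOn_finset_iff.1 h (fun i => s i - t i) (by
    simp only [sub_smul, sum_sub_distrib, hst, sub_self]) i hi
  linarith

/-- Every finite family of vectors has an independent subfamily `S` which, with suitable signs `σ`,
spans a simplicial cone such that each of the other vectors lies in the cone or in its negative. -/
lemma exists_simplicial_cone [DecidableEq ι] (y : ι → E) (J : Finset ι) :
    ∃ S ⊆ J, LinearIndepOn ℝ y (S : Set ι) ∧ ∃ σ : ι → ℝ, (∀ i, σ i = 1 ∨ σ i = -1) ∧
      ∀ j ∈ J \ S, ∃ b : ι → ℝ, b j ≠ 0 ∧ (∀ i ∈ S, 0 ≤ b i * σ i) ∧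
        (∀ i, i ∉ S → i ≠ j → b i = 0) ∧ b j • y j + ∑ i ∈ S, b i • y i = 0 := by
  classical
  obtain ⟨c, hcJ, hc⟩ := exists_generic_vector y J
  let cand : Finset (Finset ι) := J.powerset.filter fun T =>
    LinearIndepOn ℝ y (T : Set ι) ∧ c ∈ Submodule.span ℝ (y '' (T : Set ι))
  have hrep : ∀ T : Finset ι, ∃ t : ι → ℝ, c ∈ Submodule.span ℝ (y '' (T : Set ι)) →
      ∑ i ∈ T, t i • y i = c := by
    intro T
    by_cases h : c ∈ Submodule.span ℝ (y '' (T : Set ι))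
    · obtain ⟨t, ht⟩ := (Submodule.mem_span_image_finset_iff_exists_fun' ℝ).1 h
      exact ⟨t, fun _ => ht⟩
    · exact ⟨0, fun h' => absurd h' h⟩
  choose t ht using hrep
  have hcand : cand.Nonempty := by
    obtain ⟨B, hBJ, -, hspan, hB⟩ := exists_linearIndepOn_extension
      (K := ℝ) (v := y) (linearIndepOn_empty ℝ y) (Set.empty_subset (J : Set ι))
    have hBf : B.Finite := J.finite_toSet.subset hBJ
    refine ⟨hBf.toFinset, ?_⟩
    simp only [cand, mem_filter, mem_powerset, Set.Finite.coe_toFinset]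
    refine ⟨by simpa using hBJ, hB, ?_⟩
    exact Submodule.span_le.2 hspan hcJ
  obtain ⟨S, hS, hmax⟩ := exists_max_image cand (fun T => ∑ i ∈ T, |t T i|) hcand
  simp only [cand, mem_filter, mem_powerset] at hS hmax
  obtain ⟨hSJ, hSi, hSc⟩ := hS
  have hSV := hc S hSJ hSc
  have htS := ht S hSc
  -- A zero coordinate would put `c` in the span of `S.erase k`, which by genericity is then the
  -- whole span, against independence.
  have ht0 : ∀ k ∈ S, t S k ≠ 0 := by
    intro k hk h0
    have hmem : c ∈ Submodule.span ℝ (y '' ((S.erase k : Finset ι) : Set ι)) := by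
      refine (Submodule.mem_span_image_finset_iff_exists_fun' ℝ).2 ⟨t S, ?_⟩
      rw [← htS, ← add_sum_erase S _ hk, h0, zero_smul, zero_add]
    have hV := hc _ ((erase_subset k S).trans hSJ) hmem
    have hyk : y k ∈ Submodule.span ℝ (y '' ((S.erase k : Finset ι) : Set ι)) := by
      rw [hV]
      exact Submodule.subset_span ⟨k, by exact_mod_cast hSJ hk, rfl⟩
    rw [← insert_erase hk, coe_insert] at hSi
    exact hSi.notMem_span_of_insert (by simp) hyk
  refine ⟨S, hSJ, hSi, fun i => if 0 ≤ t S i then 1 else -1, fun i => by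
    dsimp only; split_ifs <;> simp, ?_⟩
  set σ : ι → ℝ := fun i => if 0 ≤ t S i then 1 else -1 with hσ
  have hσt : ∀ i, σ i * t S i = |t S i| := by
    intro i
    simp only [hσ]
    split_ifs with h
    · rw [abs_of_nonneg h, one_mul]
    · rw [abs_of_neg (not_le.1 h)]; ring
  have hσ1 : ∀ i, |σ i| = 1 := by
    intro i
    simp only [hσ]
    split_ifs <;> simp
  intro j hj
  obtain ⟨hjJ, hjS⟩ := mem_sdiff.1 hj
  have hyj : y j ∈ Submodule.span ℝ (y '' (S : Set ι)) := by
    rw [hSV]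
    exact Submodule.subset_span ⟨j, by exact_mod_cast hjJ, rfl⟩
  obtain ⟨a, ha⟩ := (Submodule.mem_span_image_finset_iff_exists_fun' ℝ).1 hyj
  -- an exchange of `k` for `j` increases the potential
  have key : ∀ s : ℝ, |s| = 1 → ∑ i ∈ S, s * a i * σ i ≤ 0 → ∀ k ∈ S, s * a k * σ k ≤ 0 := by
    intro s hs hsum k hk
    by_contra! hpos
    have hak : a k ≠ 0 := by rintro h; simp [h] at hpos
    have hss : s * s = 1 := by rw [← abs_mul_abs_self, hs, one_mul]
    have hσσ : σ k * σ k = 1 := by rw [← abs_mul_abs_self, hσ1, one_mul]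
    -- Moving by `lam` along `s • y j` cancels the coordinate of `c` at `k`.
    set lam : ℝ := |t S k| / (s * a k * σ k) with hlam
    have hlam0 : 0 < lam := div_pos (abs_pos.2 (ht0 k hk)) hpos
    have hlamk : lam * (s * a k * σ k) = |t S k| := div_mul_cancel₀ _ hpos.ne'
    let t' : ι → ℝ := fun i => if i = j then lam * s else t S i - lam * s * a i
    have ht'k : t S k - lam * s * a k = 0 := by
      have : σ k * (t S k - lam * s * a k) = 0 := by
        rw [mul_sub, hσt, ← hlamk]; ring
      rcases mul_eq_zero.1 this with h | h
      · simp [h] at hσσ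
      · exact h
    have hjk : j ∉ S.erase k := fun h => hjS (mem_of_mem_erase h)
    have hsum' : ∑ i ∈ insert j (S.erase k), t' i • y i = c := by
      rw [sum_insert hjk]
      have h1 : ∑ i ∈ S.erase k, t' i • y i = ∑ i ∈ S, (t S i - lam * s * a i) • y i := by
        rw [← add_sum_erase S _ hk, ht'k, zero_smul, zero_add]
        refine sum_congr rfl fun i hi => ?_
        have : i ≠ j := fun h => hjk (h ▸ hi)
        simp [t', this]
      rw [h1]
      simp only [sub_smul, sum_sub_distrib, htS, mul_smul, ← smul_sum, ha]
      simp [t', mul_smul]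
    have hind : LinearIndepOn ℝ y ((insert j (S.erase k) : Finset ι) : Set ι) := by
      rw [coe_insert]
      refine (hSi.mono (by exact_mod_cast erase_subset k S)).insert fun hmem => ?_
      obtain ⟨e, he⟩ := (Submodule.mem_span_image_finset_iff_exists_fun' ℝ).1 hmem
      have h2 : ∑ i ∈ S, (if i = k then 0 else e i) • y i = ∑ i ∈ S, a i • y i := by
        rw [ha, ← he, ← add_sum_erase S _ hk, if_pos rfl, zero_smul, zero_add]
        exact sum_congr rfl fun i hi => by rw [if_neg (ne_of_mem_erase hi)]
      have := coeff_eq_of_linearIndepOn hSi h2 k hk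
      simp at this
      exact hak this.symm
    have hmem : c ∈ Submodule.span ℝ (y '' ((insert j (S.erase k) : Finset ι) : Set ι)) :=
      (Submodule.mem_span_image_finset_iff_exists_fun' ℝ).2 ⟨t', hsum'⟩
    have hle := hmax _ ⟨insert_subset hjJ ((erase_subset k S).trans hSJ), hind, hmem⟩
    have heq := coeff_eq_of_linearIndepOn hind ((ht _ hmem).trans hsum'.symm)
    rw [sum_congr rfl fun i hi => by rw [heq i hi], sum_insert hjk] at hle
    -- Since `|x| ≥ σ i * x`, no other coordinate needs to keep its sign. The new coordinate at `j`
    -- adds `lam > 0`, so the norm grows strictly.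
    have h3 : ∑ i ∈ S, (|t S i| - lam * (s * a i * σ i)) ≤ ∑ i ∈ S.erase k, |t' i| := by
      rw [← add_sum_erase S _ hk, hlamk, sub_self, zero_add]
      refine sum_le_sum fun i hi => ?_
      have hij : i ≠ j := fun h => hjk (h ▸ hi)
      have : |t S i| - lam * (s * a i * σ i) = σ i * t' i := by
        simp only [t', if_neg hij]
        rw [← hσt]; ring
      rw [this]
      calc σ i * t' i ≤ |σ i * t' i| := le_abs_self _
        _ = |t' i| := by rw [abs_mul, hσ1, one_mul]
    rw [sum_sub_distrib, ← mul_sum] at h3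
    have h4 : |t' j| = lam := by simp [t', abs_mul, hs, abs_of_pos hlam0]
    have h5 : lam * ∑ i ∈ S, s * a i * σ i ≤ 0 := mul_nonpos_of_nonneg_of_nonpos hlam0.le hsum
    linarith
  obtain ⟨s, hs, hle⟩ : ∃ s : ℝ, |s| = 1 ∧ ∑ i ∈ S, s * a i * σ i ≤ 0 := by
    rcases le_total (∑ i ∈ S, a i * σ i) 0 with h | h
    · exact ⟨1, by simp, by simpa using h⟩
    · exact ⟨-1, by simp, by simpa using h⟩
  have hs0 : s ≠ 0 := by rintro rfl; simp at hs
  refine ⟨fun i => if i = j then s else if i ∈ S then -(s * a i) else 0, by simpa using hs0,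
    fun i hi => ?_, fun i hi hij => by simp [hi, hij], ?_⟩
  · have hij : i ≠ j := fun h => hjS (h ▸ hi)
    have := key s hs hle i hi
    simp only [if_neg hij, if_pos hi]
    linarith
  · have : ∑ i ∈ S, (if i = j then s else if i ∈ S then -(s * a i) else 0) • y i = -(s • y j) := by
      rw [← ha, smul_sum, ← sum_neg_distrib]
      refine sum_congr rfl fun i hi => ?_
      have hij : i ≠ j := fun h => hjS (h ▸ hi)
      rw [if_neg hij, if_pos hi, neg_smul, mul_smul]
    dsimp only
    rw [this, if_pos rfl, add_neg_cancel]

/-! ### Tolerant choice of signs -/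

/-- Among at least `t * d + 1` vectors of a space of dimension at most `d`, where `2 ≤ d`, signs can
be chosen so that after deletion of fewer than `t` vectors there remains a nontrivial linear
dependence whose coefficients agree with the signs. -/
theorem exists_signs_tolerant [DecidableEq ι] [FiniteDimensional ℝ E] {d : ℕ} (hd : 2 ≤ d)
    (hE : finrank ℝ E ≤ d) (y : ι → E) (t : ℕ) :
    ∀ J : Finset ι, t * d + 1 ≤ #J → ∃ ε : ι → ℝ, (∀ i, ε i = 1 ∨ ε i = -1) ∧
      ∀ C : Finset ι, #C < t → ∃ b : ι → ℝ, (∀ i ∈ C, b i = 0) ∧ (∀ i, i ∉ J → b i = 0) ∧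
        (∀ i, 0 ≤ b i * ε i) ∧ (∃ i, b i ≠ 0) ∧ ∑ i ∈ J, b i • y i = 0 := by
  classical
  induction t with
  | zero => exact fun J _ => ⟨1, by simp, by simp⟩
  | succ t ih =>
    intro J hJ
    obtain ⟨S, hSJ, hSi, σ, hσ, hcone⟩ := exists_simplicial_cone y J
    have hSd : #S ≤ d := by
      have := hSi.linearIndependent.fintype_card_le_finrank
      simp only [coe_sort_coe, Fintype.card_coe] at this
      exact this.trans hE
    have hR : t * d + 1 ≤ #(J \ S) := by
      rw [card_sdiff_of_subset hSJ]
      have : (t + 1) * d = t * d + d := by ring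
      omega
    obtain ⟨ε, hε, htol⟩ := ih (J \ S) hR
    choose! b hbj hbS hb0 hbsum using hcone
    -- the sign of the cone is decided by the majority of the other vectors
    obtain ⟨s, hs, hmaj⟩ : ∃ s : ℝ, (s = 1 ∨ s = -1) ∧
        t + 1 ≤ #((J \ S).filter fun j => 0 ≤ s * b j j * ε j) := by
      by_contra! h
      have h1 := h 1 (Or.inl rfl)
      have h2 := h (-1) (Or.inr rfl)
      have hcov : J \ S ⊆ ((J \ S).filter fun j => 0 ≤ 1 * b j j * ε j) ∪
          ((J \ S).filter fun j => 0 ≤ -1 * b j j * ε j) := by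
        intro j hj
        rw [← filter_or, mem_filter]
        refine ⟨hj, ?_⟩
        rcases le_total 0 (b j j * ε j) with h | h
        · left; linarith
        · right; linarith
      have h3 := (card_le_card hcov).trans (card_union_le _ _)
      -- Here `2 ≤ d` enters: at least `2 * t + 1` vectors on two sides put `t + 1` on one.
      have : t * 2 ≤ t * d := Nat.mul_le_mul_left t hd
      omega
    refine ⟨fun i => if i ∈ S then s * σ i else ε i, fun i => ?_, fun C hC => ?_⟩
    · dsimp only
      split_ifs
      · rcases hs with rfl | rfl <;> rcases hσ i with h | h <;> simp [h]
      · exact hε i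
    have hss : s * s = 1 := by rcases hs with rfl | rfl <;> norm_num
    by_cases hCS : Disjoint C S
    · obtain ⟨j, hj, hjC⟩ := exists_mem_notMem_of_card_lt_card (hC.trans_le hmaj)
      obtain ⟨hjR, hjs⟩ := mem_filter.1 hj
      obtain ⟨hjJ, hjS⟩ := mem_sdiff.1 hjR
      refine ⟨fun i => s * b j i, fun i hi => ?_, fun i hi => ?_, fun i => ?_, ⟨j, ?_⟩, ?_⟩
      · have := hb0 j hjR i (disjoint_left.1 hCS hi) (fun h => hjC (h ▸ hi))
        simp [this]
      · have := hb0 j hjR i (fun h => hi (hSJ h)) (fun h => hi (h ▸ hjJ))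
        simp [this]
      · by_cases hiS : i ∈ S
        · have := hbS j hjR i hiS
          simp only [if_pos hiS]
          calc 0 ≤ (s * s) * (b j i * σ i) := by rwa [hss, one_mul]
            _ = s * b j i * (s * σ i) := by ring
        · simp only [if_neg hiS]
          by_cases hij : i = j
          · subst hij; exact hjs
          · simp [hb0 j hjR i hiS hij]
      · have hs0 : s ≠ 0 := by rintro rfl; simp at hss
        exact mul_ne_zero hs0 (hbj j hjR)
      · have hsub : insert j S ⊆ J := insert_subset hjJ hSJ
        rw [← sum_subset hsub fun i _ hi => ?_]
        · rw [sum_insert hjS]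
          simp only [mul_smul, ← smul_sum]
          rw [← smul_add, hbsum j hjR, smul_zero]
        · simp only [mem_insert, not_or] at hi
          simp [hb0 j hjR i hi.2 hi.1]
    · obtain ⟨k, hkC, hkS⟩ := not_disjoint_iff.1 hCS
      have hcard : #(C \ S) < t := by
        have : C \ S ⊂ C := ⟨sdiff_subset, fun h => (mem_sdiff.1 (h hkC)).2 hkS⟩
        have := card_lt_card this
        omega
      obtain ⟨e, heC, heJ, heε, he0, hesum⟩ := htol (C \ S) hcard
      have heS : ∀ i ∈ S, e i = 0 := fun i hi => heJ i (by simp [hi])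
      refine ⟨e, fun i hi => ?_, fun i hi => heJ i (by simp [hi]), fun i => ?_, he0, ?_⟩
      · by_cases hiS : i ∈ S
        · exact heS i hiS
        · exact heC i (by simp [hi, hiS])
      · dsimp only
        split_ifs with hiS
        · simp [heS i hiS]
        · exact heε i
      · rw [← hesum]
        refine (sum_subset sdiff_subset fun i hi hi' => ?_).symm
        rw [heJ i hi', zero_smul]

end SignedDependences

/-! ### Colourful sets as choice functions -/

section ColourfulSets

open Finset

variable {ι κ E : Type*} [Fintype ι] [DecidableEq ι] [DecidableEq κ] [AddCommGroup E] [Module ℝ E]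

/-- The colourful set that picks the point `g j` of each class `j`. -/
def colourfulSet (g : ι → κ) : Finset (ι × κ) :=
  univ.image fun j => (j, g j)

lemma mem_colourfulSet (g : ι → κ) (p : ι × κ) : p ∈ colourfulSet g ↔ p.2 = g p.1 := by
  obtain ⟨j, t⟩ := p
  simp [colourfulSet, eq_comm]

lemma isColourful_colourfulSet (g : ι → κ) : IsColourful (colourfulSet g) := fun j =>
  ⟨g j, by simp [mem_colourfulSet], fun t ht => by simpa [mem_colourfulSet] using ht⟩

lemma removeClasses_colourfulSet (g : ι → κ) (C : Finset ι) :
    removeClasses (colourfulSet g) C = (univ \ C).image fun j => (j, g j) := by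
  ext ⟨j, t⟩
  simp only [removeClasses, mem_filter, mem_colourfulSet, mem_image, mem_sdiff, mem_univ, true_and,
    Prod.mk.injEq]
  constructor
  · rintro ⟨h, hj⟩
    exact ⟨j, hj, rfl, h.symm⟩
  · rintro ⟨i, hi, rfl, rfl⟩
    exact ⟨rfl, hi⟩

lemma sum_removeClasses_colourfulSet (z : ι → κ → E) (g : ι → κ) (C : Finset ι) (α : ι → ℝ) :
    ∑ p ∈ removeClasses (colourfulSet g) C, α p.1 • z p.1 p.2 =
      ∑ j ∈ univ \ C, α j • z j (g j) := by
  rw [removeClasses_colourfulSet, sum_image]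
  intro i _ j _ h
  exact (Prod.mk.inj h).1

lemma sum_mem_colourHull (z : ι → κ → E) (g : ι → κ) (C : Finset ι) {α : ι → ℝ}
    (hα : ∀ j ∉ C, 0 ≤ α j) (hα1 : ∑ j ∈ univ \ C, α j = 1) :
    ∑ j ∈ univ \ C, α j • z j (g j) ∈ colourHull z (removeClasses (colourfulSet g) C) := by
  refine (convex_convexHull ℝ _).sum_mem (fun j hj => hα j (mem_sdiff.1 hj).2) hα1
    fun j hj => subset_convexHull ℝ _ ⟨(j, g j), ?_, rfl⟩
  rw [removeClasses_colourfulSet]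
  exact mem_coe.2 (mem_image_of_mem _ hj)

end ColourfulSets

theorem mainTheorem3 (d r : ℕ) (hd : 2 ≤ d)
    (z : Fin ((r + 1) * d + 1) → Fin 2 → EuclideanSpace ℝ (Fin d)) :
    ∃ A₁ A₂ : Finset (Fin ((r + 1) * d + 1) × Fin 2),
      IsColourful A₁ ∧ IsColourful A₂ ∧ Disjoint A₁ A₂ ∧ A₁ ∪ A₂ = Finset.univ ∧
      ∀ C : Finset (Fin ((r + 1) * d + 1)), C.card = r →
        (colourHull z (removeClasses A₁ C) ∩ colourHull z (removeClasses A₂ C)).Nonempty ∧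
        MeetWithEqualCoefficients z A₁ A₂ C := by
  obtain ⟨ε, hε, htol⟩ := exists_signs_tolerant hd (by simp) (fun j => z j 0 - z j 1) (r + 1)
    Finset.univ (by simp)
  let g₁ : Fin ((r + 1) * d + 1) → Fin 2 := fun j => if ε j = 1 then 0 else 1
  let g₂ : Fin ((r + 1) * d + 1) → Fin 2 := fun j => if ε j = 1 then 1 else 0
  have hdiff : ∀ j, z j (g₁ j) - z j (g₂ j) = ε j • (z j 0 - z j 1) := by
    intro j
    rcases hε j with h | h
    · simp [g₁, g₂, h]
    · have : (-1 : ℝ) ≠ 1 := by norm_num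
      simp [g₁, g₂, h, this]
  refine ⟨colourfulSet g₁, colourfulSet g₂, isColourful_colourfulSet g₁,
    isColourful_colourfulSet g₂, ?_, ?_, fun C hC => ?_⟩
  · rw [Finset.disjoint_left]
    intro p h₁ h₂
    rw [mem_colourfulSet] at h₁ h₂
    rw [h₁] at h₂
    by_cases h : ε p.1 = 1 <;> simp [g₁, g₂, h] at h₂
  · refine Finset.eq_univ_of_forall fun p => ?_
    rw [Finset.mem_union, mem_colourfulSet, mem_colourfulSet]
    by_cases h : ε p.1 = 1 <;> simp only [g₁, g₂, h, if_true, if_false] <;> omega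
  obtain ⟨b, hbC, -, hbε, ⟨k, hk⟩, hsum⟩ := htol C (by omega)
  have hεε : ∀ j, ε j * ε j = 1 := fun j => by rcases hε j with h | h <;> rw [h] <;> norm_num
  -- The total weight is positive as the dependence is nontrivial; dividing by it gives convex
  -- coefficients.
  set w : ℝ := ∑ j ∈ Finset.univ \ C, b j * ε j with hw
  have hw0 : 0 < w := by
    have hε0 : ε k ≠ 0 := fun h => by simpa [h] using hεε k
    refine Finset.sum_pos' (fun j _ => hbε j)
      ⟨k, ?_, lt_of_le_of_ne (hbε k) (mul_ne_zero hk hε0).symm⟩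
    simpa using fun h => hk (hbC k h)
  let α : Fin ((r + 1) * d + 1) → ℝ := fun j => w⁻¹ * (b j * ε j)
  have hα : ∀ j ∉ C, 0 ≤ α j := fun j _ => mul_nonneg (inv_nonneg.2 hw0.le) (hbε j)
  have hα1 : ∑ j ∈ Finset.univ \ C, α j = 1 := by
    rw [← Finset.mul_sum, ← hw, inv_mul_cancel₀ hw0.ne']
  have heq : ∑ j ∈ Finset.univ \ C, α j • z j (g₁ j) =
      ∑ j ∈ Finset.univ \ C, α j • z j (g₂ j) := by
    rw [← sub_eq_zero, ← Finset.sum_sub_distrib]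
    have hterm : ∀ j, α j • z j (g₁ j) - α j • z j (g₂ j) = w⁻¹ • b j • (z j 0 - z j 1) := by
      intro j
      rw [← smul_sub, hdiff, smul_smul, smul_smul]
      congr 1
      calc w⁻¹ * (b j * ε j) * ε j = w⁻¹ * (b j * (ε j * ε j)) := by ring
        _ = w⁻¹ * b j := by rw [hεε, mul_one]
    simp only [hterm, ← Finset.smul_sum]
    rw [Finset.sum_subset (Finset.sdiff_subset : Finset.univ \ C ⊆ Finset.univ) fun j _ hj => ?_,
      hsum, smul_zero]
    rw [hbC j (by simpa using hj), zero_smul]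
  refine ⟨⟨_, sum_mem_colourHull z g₁ C hα hα1, ?_⟩, α, hα, hα1, ?_⟩
  · rw [heq]
    exact sum_mem_colourHull z g₂ C hα hα1
  · rw [sum_removeClasses_colourfulSet, sum_removeClasses_colourfulSet, heq]
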